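/- **Theorem 4.8 (Menelaus's theorem for geodesic triangles in general location).** Let $X$ be $\mathbf S^2\times\mathbf R$ or $\mathbf H^2\times\mathbf R$ in the affine coordinates of the projective model with centre $E_0=(0,0,0)$. Thus $\mathbf S^2\times\mathbf R=\mathbf R^3\setminus\{0\}$ with $ds^2=(dx^2+dy^2+dz^2)/(x^2+y^2+z^2)$. And $\mathbf H^2\times\mathbf R=\{-x^2+y^2+z^2<0<x\}$ carries the product metric that in the coordinates $(x,y,z)=e^t(\cosh r,\ \sinh r\cos\alpha,\ \sinh r\sin\alpha)$ reads $ds^2=dt^2+dr^2+\sinh^2 r\,d\alpha^2$. The fibres are the open rays from $E_0$, and the base plane is the unit sphere, respectively the sheet $x^2-y^2-z^2=1$, $x>0$. Let $d$ be the geodesic distance of $X$, that is, the least arc length of a geodesic joining two points. Up to isometry every geodesic is $\gamma(\tau)=e^{\tau\sin v}\,(\mathrm c(\tau\cos v),\ \mathrm s(\tau\cos v)\cos u,\ \mathrm s(\tau\cos v)\sin u)$, $\tau\in\mathbf R$, with $|v|\le\pi/2$, where $(\mathrm c,\mathrm s)=(\cos,\sin)$, respectively $(\cosh,\sinh)$.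 The number $v$ is its slope parameter, and it is fibre-like if $\cos v=0$. In $\mathbf S^2\times\mathbf R$, arcs of geodesics between any two of the points under consideration are taken to project to arcs of at most a semicircle of the base sphere. *Simple ratio.* For points $A,P,B$ of a geodesic with parameter $v$, not fibre-like, put $$s_g(A,P,B)=\pm\frac{w(d(A,P)\cos v)}{w(d(P,B)\cos v)},$$ with $w=\sin$ for $\mathbf S^2\times\mathbf R$ and $w=\sinh$ for $\mathbf H^2\times\mathbf R$, and with the sign $+$ if $P$ is between $A$ and $B$ (that is, $d(A,P)+d(P,B)=d(A,B)$) and $-$ otherwise. *Surface of a triangle.* For $A_0,A_1,A_2\in X$ and $\lambda_1,\lambda_2>0$ let $\mathcal C(\lambda_1,\lambda_2)$ be the set of all $Y\in X$ with $d(A_0,Y)=\lambda_1 d(Y,A_1)$ and $d(A_2,Y)=\lambda_2 d(Y,A_0)$. Put $\mathcal C(0,\lambda_2)=\{A_0\}$ for $\lambda_2>0$ and $\mathcal C(\lambda_1,0)=\{A_2\}$ for $\lambda_1>0$. The surface $\mathcal S_{A_0A_1A_2}$ consists of $A_1$ (the case $\lambda_1=\infty$) and of all points that are nearest to $A_0$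 in some $\mathcal C(\lambda_1,\lambda_2)$ with $\lambda_1,\lambda_2\ge 0$ not both $0$. The triangle is in general location if $\mathcal S_{A_0A_1A_2}$ is not contained in a Euclidean plane through $E_0$. *Lines.* Let $S$ be $\mathcal S_{A_0A_1A_2}$ or a prolongation of it, i.e. any set with $\mathcal S_{A_0A_1A_2}\subseteq S\subseteq X$. A line of $S$ is the image in $S$, under central projection from $E_0$, of a complete geodesic curve, not fibre-like, that joins two distinct points of $S$: the set of the points of $S$ that lie on a ray from $E_0$ through a point of the geodesic. **Claim.** Let $A_0,A_1,A_2\in X$ be a geodesic triangle in general location, $S$ as above, and $l$ a line of $S$ that contains none of $A_0,A_1,A_2$. If $l$ meets the geodesic curves $g_{A_0A_1}$, $g_{A_1A_2}$, $g_{A_2A_0}$ (sides or their extensions) in $P$, $Q$, $R$ respectively, then $$s_g(A_0,P,A_1)\;s_g(A_1,Q,A_2)\;s_g(A_2,R,A_0)=-1 .$$ -/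

import Mathlib

/-- The two product geometries considered: `S² × ℝ` and `H² × ℝ`. -/
inductive ProductGeometry where
  | S2R
  | H2R

namespace ProductGeometry

/-- The sign `ε` of the form `x x' + ε (y y' + z z')` attached to the geometry. -/
def sign : ProductGeometry → ℝ
  | S2R => 1
  | H2R => -1

/-- The bilinear form of the projective model, in the affine coordinates `(x, y, z)`
(the homogeneous coordinates are `(1, x, y, z)`). -/
def form (X : ProductGeometry) (p q : Fin 3 → ℝ) : ℝ :=
  p 0 * q 0 + X.sign * (p 1 * q 1 + p 2 * q 2)

/-- The proper points of the model. For `S² × ℝ`: the affine space without the centre `E₀`, the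
origin. For `H² × ℝ`: the open half cone `-x² + y² + z² < 0 < x`.
The fibres are the open rays from `E₀`. The base plane is the unit sphere
`x² + y² + z² = 1`, respectively the hyperboloid sheet `x² - y² - z² = 1`, `0 < x`. -/
def space : ProductGeometry → Set (Fin 3 → ℝ)
  | S2R => {p | p ≠ 0}
  | H2R => {p | 0 < H2R.form p p ∧ 0 < p 0}

/-- The arc length element: the square of the length of the tangent vector `w` at `p`. -/
noncomputable def metric : ProductGeometry → (Fin 3 → ℝ) → (Fin 3 → ℝ) → ℝ
  | S2R, p, w => (w 0 ^ 2 + w 1 ^ 2 + w 2 ^ 2) / (p 0 ^ 2 + p 1 ^ 2 + p 2 ^ 2)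
  | H2R, p, w =>
      ((p 0 ^ 2 + p 1 ^ 2 + p 2 ^ 2) * w 0 ^ 2
        + 2 * w 0 * w 1 * (-2 * p 0 * p 1) + 2 * w 0 * w 2 * (-2 * p 0 * p 2)
        + (p 0 ^ 2 + p 1 ^ 2 - p 2 ^ 2) * w 1 ^ 2 + 2 * w 1 * w 2 * (2 * p 1 * p 2)
        + (p 0 ^ 2 - p 1 ^ 2 + p 2 ^ 2) * w 2 ^ 2)
      / (-p 0 ^ 2 + p 1 ^ 2 + p 2 ^ 2) ^ 2

/-- `cos` or `cosh`. -/
noncomputable def genCos : ProductGeometry → ℝ → ℝ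
  | S2R => Real.cos
  | H2R => Real.cosh

/-- `sin` or `sinh`: the function `w` occurring in simple ratios. -/
noncomputable def genSin : ProductGeometry → ℝ → ℝ
  | S2R => Real.sin
  | H2R => Real.sinh

/-- The data of a complete geodesic curve: the initial point `exp t₀ • a`, where `a` lies in the
base plane, a unit tangent vector `b` of the base plane at `a`, and the slope parameter `v`.
The geodesics with `a = (1,0,0)`, `b = (0, cos u, sin u)`, `t₀ = 0` are those starting at the point
`(1,0,0)`. The others are their images under isometries. -/
structure Geodesic (X : ProductGeometry) where
  t₀ : ℝ
  a : Fin 3 → ℝ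
  b : Fin 3 → ℝ
  v : ℝ
  a_mem : a ∈ X.space
  form_a : X.form a a = 1
  form_b : X.form b b = X.sign
  form_ab : X.form a b = 0
  v_mem : v ∈ Set.Icc (-(Real.pi / 2)) (Real.pi / 2)

variable {X : ProductGeometry}

/-- The geodesic curve with the given data, as a parametrized curve. -/
noncomputable def Geodesic.curve (g : X.Geodesic) (τ : ℝ) : Fin 3 → ℝ :=
  Real.exp (g.t₀ + τ * Real.sin g.v) •
    (X.genCos (τ * Real.cos g.v) • g.a + X.genSin (τ * Real.cos g.v) • g.b)

/-- The arc length of the part of a geodesic curve between the parameters `σ ≤ τ`. -/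
noncomputable def Geodesic.arcLength (g : X.Geodesic) (σ τ : ℝ) : ℝ :=
  ∫ s in σ..τ, √(X.metric (g.curve s) (deriv g.curve s))

/-- The distance of two points: the least arc length of a geodesic curve from `p` to `q`. -/
noncomputable def dist (X : ProductGeometry) (p q : Fin 3 → ℝ) : ℝ :=
  sInf {L | ∃ (g : X.Geodesic) (σ τ : ℝ), σ ≤ τ ∧ g.curve σ = p ∧ g.curve τ = q ∧
    L = g.arcLength σ τ}

/-- A geodesic is fibre-like if it runs inside a fibre. -/
def Geodesic.IsFibreLike (g : X.Geodesic) : Prop := Real.cos g.v = 0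

/-- In `S² × ℝ`, the arc between two parameters projects to an arc of at most a
semicircle of the base sphere. There is no restriction in `H² × ℝ`. -/
def Geodesic.AdmissibleArc (g : X.Geodesic) (σ τ : ℝ) : Prop :=
  X = S2R → |σ - τ| * Real.cos g.v ≤ Real.pi

/-- The geodesic `g` connects `A` and `B` (by an admissible arc). -/
def Geodesic.Connects (g : X.Geodesic) (A B : Fin 3 → ℝ) : Prop :=
  ∃ σ τ, g.curve σ = A ∧ g.curve τ = B ∧ g.AdmissibleArc σ τ

/-- `g` is a geodesic curve `g_{AB}`, and `P` is a point of it; the arcs between the three points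
are admissible. -/
def Geodesic.ConnectsThrough (g : X.Geodesic) (A P B : Fin 3 → ℝ) : Prop :=
  ∃ σ ρ τ, g.curve σ = A ∧ g.curve ρ = P ∧ g.curve τ = B ∧
    g.AdmissibleArc σ τ ∧ g.AdmissibleArc σ ρ ∧ g.AdmissibleArc ρ τ

open Classical in
/-- The generalized simple ratio `s_g(A, P, B)` of points of a geodesic curve `g` that is
not fibre-like. `P` is between `A` and `B` when `d(A,P) + d(P,B) = d(A,B)`. -/
noncomputable def Geodesic.simpleRatio (g : X.Geodesic) (A P B : Fin 3 → ℝ) : ℝ :=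
  if X.dist A P + X.dist P B = X.dist A B then
    X.genSin (X.dist A P * Real.cos g.v) / X.genSin (X.dist P B * Real.cos g.v)
  else
    -(X.genSin (X.dist A P * Real.cos g.v) / X.genSin (X.dist P B * Real.cos g.v))

/-- The Apollonius surface of `P₁`, `P₂` with ratio `r`. -/
def apollonius (X : ProductGeometry) (P₁ P₂ : Fin 3 → ℝ) (r : ℝ) : Set (Fin 3 → ℝ) :=
  {Y | Y ∈ X.space ∧ X.dist P₁ Y = r * X.dist Y P₂}

open Classical in
/-- The intersection `C(r₁, r₂)` of the Apollonius surface of `A₀, A₁` with ratio `r₁` and that of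
`A₂, A₀` with ratio `r₂`; by convention `{A₀}` if `r₁ = 0`, and `{A₂}` if `r₂ = 0`. -/
noncomputable def apolloniusCurve (X : ProductGeometry) (A₀ A₁ A₂ : Fin 3 → ℝ) (r₁ r₂ : ℝ) :
    Set (Fin 3 → ℝ) :=
  if r₁ = 0 then {A₀} else if r₂ = 0 then {A₂} else
    X.apollonius A₀ A₁ r₁ ∩ X.apollonius A₂ A₀ r₂

/-- The points of `C(r₁, r₂)` that are nearest to `A₀`. -/
def nearestPoints (X : ProductGeometry) (A₀ A₁ A₂ : Fin 3 → ℝ) (r₁ r₂ : ℝ) : Set (Fin 3 → ℝ) :=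
  {P | P ∈ X.apolloniusCurve A₀ A₁ A₂ r₁ r₂ ∧
    ∀ Q ∈ X.apolloniusCurve A₀ A₁ A₂ r₁ r₂, X.dist P A₀ ≤ X.dist Q A₀}

/-- The surface of the geodesic triangle `A₀A₁A₂`. The vertex `A₁` belongs to the ratio
`r₁ = ∞`, whose Apollonius surface is the point `A₁`, and is adjoined. -/
def triangleSurface (X : ProductGeometry) (A₀ A₁ A₂ : Fin 3 → ℝ) : Set (Fin 3 → ℝ) :=
  {P | ∃ r₁ r₂ : ℝ, 0 ≤ r₁ ∧ 0 ≤ r₂ ∧ 0 < r₁ ^ 2 + r₂ ^ 2 ∧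
    P ∈ X.nearestPoints A₀ A₁ A₂ r₁ r₂} ∪ {A₁}

/-- The triangle is of fibre type if its surface lies in a Euclidean plane
`u₀ x + u₁ y + u₂ z = 0` through the centre `E₀`. -/
def IsFibreType (X : ProductGeometry) (A₀ A₁ A₂ : Fin 3 → ℝ) : Prop :=
  ∃ u : Fin 3 → ℝ, u ≠ 0 ∧ ∀ P ∈ X.triangleSurface A₀ A₁ A₂, u ⬝ᵥ P = 0

/-- A triangle in general location is one that is not of fibre type. -/
def IsGeneralLocation (X : ProductGeometry) (A₀ A₁ A₂ : Fin 3 → ℝ) : Prop :=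
  ¬ X.IsFibreType A₀ A₁ A₂

/-- The image of the complete geodesic curve `g` in `S` under the central projection with
centre `E₀`: the points of `S` that lie on a ray from `E₀` through a point of `g`. -/
def Geodesic.centralImage (g : X.Geodesic) (S : Set (Fin 3 → ℝ)) : Set (Fin 3 → ℝ) :=
  {Q | Q ∈ S ∧ ∃ τ c : ℝ, 0 < c ∧ Q = c • g.curve τ}

/-- `l` is a line of the surface `S`: the central image in `S` of a geodesic curve, not
fibre-like, that connects two distinct points of `S`. -/
def IsLineIn (X : ProductGeometry) (S l : Set (Fin 3 → ℝ)) : Prop :=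
  ∃ P₁ ∈ S, ∃ P₂ ∈ S, P₁ ≠ P₂ ∧
    ∃ g : X.Geodesic, ¬ g.IsFibreLike ∧ g.Connects P₁ P₂ ∧ l = g.centralImage S

end ProductGeometry

/-! Menelaus reduces to linear algebra in the ambient space. The central image of a geodesic that is
not fibre-like is the section of `S` by a plane through the centre (`mem_centralImage_iff`). Let `n`
be a normal of the plane of `l`, and let `h` be the pairing with `n` of the projection to the base
plane (`baseHeight`). The base points of a side at three parameters satisfy a linear relation with
generalized sines as coefficients (`genSin_smul_basePoint_add`). Pairing it with `n` at a point of
`l` gives the simple ratio `-(h A / h B)` (`simpleRatio_eq_neg_div`). The vertices are off `l`, so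
their values of `h` are nonzero and the product telescopes to `(-1)^3`. The metric part is
`dist_curve`: an admissible arc has distance equal to its parameter difference, so the simple ratio
is a quotient of signed generalized sines. -/

namespace ProductGeometry

variable {X : ProductGeometry}

/-! ### Trigonometry common to both geometries -/

lemma sign_mul_sign (X : ProductGeometry) : X.sign * X.sign = 1 := by
  cases X <;> norm_num [sign]

lemma genCos_sq_add (X : ProductGeometry) (x : ℝ) :
    X.genCos x ^ 2 + X.sign * X.genSin x ^ 2 = 1 := by
  cases X
  · simp [genCos, genSin, sign]
  · simp only [genCos, genSin, sign]
    linarith [Real.cosh_sq x]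

lemma genCos_sub (X : ProductGeometry) (x y : ℝ) :
    X.genCos (x - y) = X.genCos x * X.genCos y + X.sign * (X.genSin x * X.genSin y) := by
  cases X
  · simp [genCos, genSin, sign, Real.cos_sub]
  · simp only [genCos, genSin, sign, Real.cosh_sub]
    ring

lemma genSin_sub (X : ProductGeometry) (x y : ℝ) :
    X.genSin (x - y) = X.genSin x * X.genCos y - X.genCos x * X.genSin y := by
  cases X
  · simp [genCos, genSin, Real.sin_sub]
  · simp [genCos, genSin, Real.sinh_sub]

lemma genSin_neg (X : ProductGeometry) (x : ℝ) : X.genSin (-x) = -X.genSin x := by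
  cases X <;> simp [genSin]

lemma genCos_neg (X : ProductGeometry) (x : ℝ) : X.genCos (-x) = X.genCos x := by
  cases X <;> simp [genCos]

lemma genSin_zero (X : ProductGeometry) : X.genSin 0 = 0 := by
  cases X <;> simp [genSin]

lemma hasDerivAt_genCos (X : ProductGeometry) (x : ℝ) :
    HasDerivAt X.genCos (-X.sign * X.genSin x) x := by
  cases X
  · simpa [genCos, genSin, sign] using Real.hasDerivAt_cos x
  · simpa [genCos, genSin, sign] using Real.hasDerivAt_cosh x

lemma hasDerivAt_genSin (X : ProductGeometry) (x : ℝ) :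
    HasDerivAt X.genSin (X.genCos x) x := by
  cases X
  · simpa [genCos, genSin] using Real.hasDerivAt_sin x
  · simpa [genCos, genSin] using Real.hasDerivAt_sinh x

/-- The generalized cosine determines angles up to a semicircle. -/
lemma le_of_genCos_eq {x y : ℝ} (hx : 0 ≤ x) (hy : 0 ≤ y) (hxπ : X = S2R → x ≤ Real.pi)
    (h : X.genCos x = X.genCos y) : x ≤ y := by
  by_contra! hlt
  cases X
  · exact (Real.cos_lt_cos_of_nonneg_of_le_pi hy (hxπ rfl) hlt).ne h
  · have := Real.cosh_lt_cosh.2 (show |y| < |x| by rwa [abs_of_nonneg hx, abs_of_nonneg hy])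
    exact this.ne h.symm

/-! ### The bilinear form and the metric -/

lemma form_smul_smul (X : ProductGeometry) (r s : ℝ) (p q : Fin 3 → ℝ) :
    X.form (r • p) (s • q) = r * s * X.form p q := by
  simp only [form, Pi.smul_apply, smul_eq_mul]; ring

lemma form_comb (X : ProductGeometry) (r s r' s' : ℝ) (p q : Fin 3 → ℝ) :
    X.form (r • p + s • q) (r' • p + s' • q) =
      r * r' * X.form p p + (r * s' + s * r') * X.form p q + s * s' * X.form q q := by
  simp only [form, Pi.smul_apply, Pi.add_apply, smul_eq_mul]; ring

/-- The metric in terms of the form: the height and the base part of a tangent vector are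
separated by the form-orthogonal decomposition. -/
lemma metric_eq (X : ProductGeometry) (p w : Fin 3 → ℝ) (hp : X.form p p ≠ 0) :
    X.metric p w = ((1 - X.sign) * X.form p w ^ 2 + X.sign * X.form p p * X.form w w)
      / X.form p p ^ 2 := by
  cases X
  · simp only [metric, form, sign] at hp ⊢
    have h : p 0 ^ 2 + p 1 ^ 2 + p 2 ^ 2 ≠ 0 := by
      intro h; apply hp; linarith
    have h' : p 0 * p 0 + 1 * (p 1 * p 1 + p 2 * p 2) = p 0 ^ 2 + p 1 ^ 2 + p 2 ^ 2 := by ring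
    rw [h']
    field_simp
    ring
  · simp only [metric, form, sign]
    congr 1 <;> ring

/-! ### Geodesics, distance and the simple ratio -/

namespace Geodesic

/-- The projection of a geodesic curve to the base plane. -/
noncomputable def basePoint (g : X.Geodesic) (τ : ℝ) : Fin 3 → ℝ :=
  X.genCos (τ * Real.cos g.v) • g.a + X.genSin (τ * Real.cos g.v) • g.b

/-- The velocity of the projected curve, as a unit vector. -/
noncomputable def baseTangent (g : X.Geodesic) (τ : ℝ) : Fin 3 → ℝ :=
  (-X.sign * X.genSin (τ * Real.cos g.v)) • g.a + X.genCos (τ * Real.cos g.v) • g.b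

lemma curve_eq (g : X.Geodesic) (τ : ℝ) :
    g.curve τ = Real.exp (g.t₀ + τ * Real.sin g.v) • g.basePoint τ := rfl

lemma cos_nonneg (g : X.Geodesic) : 0 ≤ Real.cos g.v := Real.cos_nonneg_of_mem_Icc g.v_mem

/-- By the subtraction formula, the form of two base points records the length of the base arc
between them. -/
lemma form_basePoint (g : X.Geodesic) (σ τ : ℝ) :
    X.form (g.basePoint σ) (g.basePoint τ) = X.genCos ((τ - σ) * Real.cos g.v) := by
  rw [basePoint, basePoint, form_comb, g.form_a, g.form_ab, g.form_b, sub_mul, genCos_sub]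
  ring

lemma form_basePoint_self (g : X.Geodesic) (τ : ℝ) :
    X.form (g.basePoint τ) (g.basePoint τ) = 1 := by
  rw [basePoint, form_comb, g.form_a, g.form_ab, g.form_b]
  linear_combination X.genCos_sq_add (τ * Real.cos g.v)

lemma form_basePoint_baseTangent (g : X.Geodesic) (τ : ℝ) :
    X.form (g.basePoint τ) (g.baseTangent τ) = 0 := by
  rw [basePoint, baseTangent, form_comb, g.form_a, g.form_ab, g.form_b]
  ring

lemma form_baseTangent_self (g : X.Geodesic) (τ : ℝ) :
    X.form (g.baseTangent τ) (g.baseTangent τ) = X.sign := by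
  rw [baseTangent, form_comb, g.form_a, g.form_ab, g.form_b]
  linear_combination X.sign * X.genCos_sq_add (τ * Real.cos g.v)

lemma form_curve (g : X.Geodesic) (σ τ : ℝ) :
    X.form (g.curve σ) (g.curve τ) = Real.exp (g.t₀ + σ * Real.sin g.v) *
      Real.exp (g.t₀ + τ * Real.sin g.v) * X.genCos ((τ - σ) * Real.cos g.v) := by
  rw [curve_eq, curve_eq, form_smul_smul, form_basePoint]

lemma form_curve_self (g : X.Geodesic) (τ : ℝ) :
    X.form (g.curve τ) (g.curve τ) = Real.exp (g.t₀ + τ * Real.sin g.v) ^ 2 := by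
  rw [curve_eq, form_smul_smul, form_basePoint_self]; ring

lemma hasDerivAt_curve (g : X.Geodesic) (τ : ℝ) :
    HasDerivAt g.curve (Real.exp (g.t₀ + τ * Real.sin g.v) •
      (Real.sin g.v • g.basePoint τ + Real.cos g.v • g.baseTangent τ)) τ := by
  have hm (c : ℝ) : HasDerivAt (fun τ : ℝ => τ * c) c τ := by
    simpa using (hasDerivAt_id τ).mul_const c
  have he := ((hm (Real.sin g.v)).const_add g.t₀).exp
  have hC := ((X.hasDerivAt_genCos (τ * Real.cos g.v)).comp τ (hm _)).smul_const g.a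
  have hS := ((X.hasDerivAt_genSin (τ * Real.cos g.v)).comp τ (hm _)).smul_const g.b
  refine (he.smul (hC.add hS)).congr_deriv ?_
  ext i
  simp only [basePoint, baseTangent, Pi.add_apply, Pi.smul_apply, smul_eq_mul, Function.comp]
  ring

/-- The velocity splits into a fibre part `sin v` and an orthogonal base part `cos v`, so the
parameter is arc length. -/
lemma metric_deriv_curve (g : X.Geodesic) (τ : ℝ) :
    X.metric (g.curve τ) (deriv g.curve τ) = 1 := by
  have hs := g.form_curve_self τ
  have he := Real.exp_pos (g.t₀ + τ * Real.sin g.v)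
  rw [metric_eq _ _ _ (by rw [hs]; positivity), hs, (g.hasDerivAt_curve τ).deriv]
  have h1 : X.form (g.curve τ) (Real.exp (g.t₀ + τ * Real.sin g.v) •
      (Real.sin g.v • g.basePoint τ + Real.cos g.v • g.baseTangent τ)) =
      Real.exp (g.t₀ + τ * Real.sin g.v) ^ 2 * Real.sin g.v := by
    rw [curve_eq, form_smul_smul]
    have := X.form_comb 1 0 (Real.sin g.v) (Real.cos g.v) (g.basePoint τ) (g.baseTangent τ)
    rw [one_smul, zero_smul, add_zero] at this
    rw [this, form_basePoint_self, form_basePoint_baseTangent]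
    ring
  rw [h1, form_smul_smul, form_comb, form_basePoint_self, form_basePoint_baseTangent,
    form_baseTangent_self, div_eq_one_iff_eq (by positivity)]
  linear_combination Real.exp (g.t₀ + τ * Real.sin g.v) ^ 4 *
    (Real.cos g.v ^ 2 * X.sign_mul_sign + Real.sin_sq_add_cos_sq g.v)

lemma arcLength_eq (g : X.Geodesic) (σ τ : ℝ) : g.arcLength σ τ = τ - σ := by
  simp [arcLength, metric_deriv_curve]

/-- The geodesic run through in the opposite direction. -/
def reverse (g : X.Geodesic) : X.Geodesic where
  t₀ := g.t₀
  a := g.a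
  b := -g.b
  v := -g.v
  a_mem := g.a_mem
  form_a := g.form_a
  form_b := by rw [← g.form_b]; simp [form]
  form_ab := by rw [← neg_eq_zero, ← g.form_ab]; simp [form]; ring
  v_mem := ⟨by linarith [g.v_mem.2], by linarith [g.v_mem.1]⟩

lemma curve_reverse (g : X.Geodesic) (τ : ℝ) : g.reverse.curve τ = g.curve (-τ) := by
  simp [curve, reverse, genSin_neg, genCos_neg]

/-- A geodesic arc that projects to at most a semicircle is shortest. -/
lemma abs_sub_le_of_curve_eq {g g' : X.Geodesic} {σ τ σ' τ' : ℝ} (h : g.AdmissibleArc σ τ)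
    (hσ : g'.curve σ' = g.curve σ) (hτ : g'.curve τ' = g.curve τ) : |σ - τ| ≤ |σ' - τ'| := by
  -- The form of a point with itself determines its height along the fibre.
  have height {s s' : ℝ} (hs : g'.curve s' = g.curve s) :
      g'.t₀ + s' * Real.sin g'.v = g.t₀ + s * Real.sin g.v := by
    have := g'.form_curve_self s'
    rw [hs, g.form_curve_self] at this
    exact (Real.exp_injective ((pow_left_inj₀ (Real.exp_pos _).le (Real.exp_pos _).le
      two_ne_zero).1 this)).symm
  -- With equal heights, the form of the two endpoints leaves only the generalized cosine of the
  -- base arc.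
  have hgen : X.genCos (|σ - τ| * Real.cos g.v) = X.genCos (|σ' - τ'| * Real.cos g'.v) := by
    have heven (s t c : ℝ) : X.genCos (|s - t| * c) = X.genCos ((t - s) * c) := by
      rcases abs_choice (s - t) with h | h <;> rw [h]
      · rw [← genCos_neg]; congr 1; ring
      · congr 1; ring
    have := g'.form_curve σ' τ'
    rw [hσ, hτ, g.form_curve, height hσ, height hτ] at this
    rw [heven, heven]
    exact mul_left_cancel₀ (by positivity) this
  have hle := le_of_genCos_eq (mul_nonneg (abs_nonneg _) g.cos_nonneg)
    (mul_nonneg (abs_nonneg _) g'.cos_nonneg) h hgen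
  have hsq := pow_le_pow_left₀ (mul_nonneg (abs_nonneg _) g.cos_nonneg) hle 2
  rw [mul_pow, mul_pow, sq_abs, sq_abs] at hsq
  have hh : (σ - τ) * Real.sin g.v = (σ' - τ') * Real.sin g'.v := by
    linarith [height hσ, height hτ]
  refine sq_le_sq.1 ?_
  -- Pythagoras: squared length is squared base length plus squared height difference; the latter is
  -- common to both arcs.
  calc (σ - τ) ^ 2 = (σ - τ) ^ 2 * Real.cos g.v ^ 2 + ((σ - τ) * Real.sin g.v) ^ 2 := by
        linear_combination -(σ - τ) ^ 2 * Real.sin_sq_add_cos_sq g.v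
    _ ≤ (σ' - τ') ^ 2 * Real.cos g'.v ^ 2 + ((σ' - τ') * Real.sin g'.v) ^ 2 := by
        rw [hh]; linarith
    _ = (σ' - τ') ^ 2 := by
        linear_combination (σ' - τ') ^ 2 * Real.sin_sq_add_cos_sq g'.v

lemma dist_curve (g : X.Geodesic) {σ τ : ℝ} (h : g.AdmissibleArc σ τ) :
    X.dist (g.curve σ) (g.curve τ) = |σ - τ| := by
  refine IsLeast.csInf_eq ⟨?_, ?_⟩
  · rcases le_total σ τ with hle | hle
    · exact ⟨g, σ, τ, hle, rfl, rfl, by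
        rw [arcLength_eq, abs_of_nonpos (by linarith)]; ring⟩
    · exact ⟨g.reverse, -σ, -τ, by linarith, by simp [curve_reverse], by simp [curve_reverse], by
        rw [arcLength_eq, abs_of_nonneg (by linarith)]; ring⟩
  · rintro _ ⟨g', σ', τ', hle, hσ, hτ, rfl⟩
    rw [arcLength_eq, ← abs_of_nonneg (sub_nonneg.2 hle), abs_sub_comm τ' σ']
    exact abs_sub_le_of_curve_eq h hσ hτ

/-- The simple ratio as a quotient of signed generalized sines. -/
lemma simpleRatio_curve (g : X.Geodesic) {σ ρ τ : ℝ} (hστ : g.AdmissibleArc σ τ)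
    (hσρ : g.AdmissibleArc σ ρ) (hρτ : g.AdmissibleArc ρ τ) :
    g.simpleRatio (g.curve σ) (g.curve ρ) (g.curve τ) =
      X.genSin ((ρ - σ) * Real.cos g.v) / X.genSin ((τ - ρ) * Real.cos g.v) := by
  rw [simpleRatio, g.dist_curve hστ, g.dist_curve hσρ, g.dist_curve hρτ]
  have hneg (s t c : ℝ) : X.genSin ((s - t) * c) = -X.genSin ((t - s) * c) := by
    rw [← genSin_neg]; congr 1; ring
  rcases le_total σ ρ with h1 | h1 <;> rcases le_total ρ τ with h2 | h2
  · rw [abs_of_nonpos (by linarith : σ - ρ ≤ 0), abs_of_nonpos (by linarith : ρ - τ ≤ 0),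
      abs_of_nonpos (by linarith : σ - τ ≤ 0), if_pos (by ring), neg_sub, neg_sub]
  · rw [abs_of_nonpos (by linarith : σ - ρ ≤ 0), abs_of_nonneg (by linarith : 0 ≤ ρ - τ), neg_sub,
      hneg τ ρ, div_neg]
    split_ifs with h
    -- Betweenness outside the open arc forces `P` to be an endpoint; both signs then give `0`,
    -- using `x / 0 = 0` at the second endpoint.
    · have h' : ρ = σ ∨ ρ = τ := by
        rcases abs_choice (σ - τ) with e | e <;> rw [e] at h
        · left; linarith
        · right; linarith
      rcases h' with rfl | rfl <;> simp [genSin_zero]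
    · rfl
  · rw [abs_of_nonneg (by linarith : 0 ≤ σ - ρ), abs_of_nonpos (by linarith : ρ - τ ≤ 0), neg_sub,
      hneg ρ σ, neg_div]
    split_ifs with h
    · have h' : ρ = σ ∨ ρ = τ := by
        rcases abs_choice (σ - τ) with e | e <;> rw [e] at h
        · right; linarith
        · left; linarith
      rcases h' with rfl | rfl <;> simp [genSin_zero]
    · rfl
  · rw [abs_of_nonneg (by linarith : 0 ≤ σ - ρ), abs_of_nonneg (by linarith : 0 ≤ ρ - τ),
      abs_of_nonneg (by linarith : 0 ≤ σ - τ), if_pos (by ring), hneg ρ σ, hneg τ ρ, neg_div_neg_eq]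

lemma genSin_smul_basePoint_add (g : X.Geodesic) (σ ρ τ : ℝ) :
    X.genSin ((τ - ρ) * Real.cos g.v) • g.basePoint σ +
      X.genSin ((ρ - σ) * Real.cos g.v) • g.basePoint τ =
      X.genSin ((τ - σ) * Real.cos g.v) • g.basePoint ρ := by
  simp only [sub_mul, genSin_sub, basePoint]
  module

/-! ### Central images as plane sections -/

/-- The normal vector of the plane through the centre spanned by a geodesic that is not
fibre-like. -/
def normal (g : X.Geodesic) : Fin 3 → ℝ := crossProduct g.a g.b

lemma curve_dotProduct_normal (g : X.Geodesic) (τ : ℝ) : g.curve τ ⬝ᵥ g.normal = 0 := by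
  simp [curve, normal, add_dotProduct, smul_dotProduct, dot_self_cross, dot_cross_self]

/-- A point of the plane spanned by `a` and `b` is a linear combination of them. -/
lemma exists_eq_comb (g : X.Geodesic) {x : Fin 3 → ℝ} (hx : x ⬝ᵥ g.normal = 0) :
    ∃ r s : ℝ, x = r • g.a + s • g.b := by
  rw [normal, triple_product_eq_det] at hx
  obtain ⟨w, hw0, hw⟩ := Matrix.exists_vecMul_eq_zero_iff.2 hx
  have hrel : w 0 • x + w 1 • g.a + w 2 • g.b = 0 := by
    rw [← hw]
    ext i
    simp [Matrix.vecMul, dotProduct, Fin.sum_univ_three]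
  -- Otherwise `a` and `b` would be dependent, although they are orthogonal with nonzero form.
  have h0 : w 0 ≠ 0 := by
    intro h0
    rw [h0, zero_smul, zero_add] at hrel
    have hz (p : Fin 3 → ℝ) : X.form p 0 = 0 := by simp [form]
    have ha := X.form_comb 1 0 (w 1) (w 2) g.a g.b
    have hb := X.form_comb 0 1 (w 1) (w 2) g.a g.b
    rw [hrel, hz, g.form_a, g.form_ab, g.form_b] at ha hb
    have h1 : w 1 = 0 := by linarith
    have h2 : w 2 = 0 := by linear_combination -w 2 * X.sign_mul_sign - X.sign * hb
    apply hw0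
    ext i
    fin_cases i <;> simp [h0, h1, h2]
  refine ⟨-(w 1 / w 0), -(w 2 / w 0), ?_⟩
  ext i
  have := congrFun hrel i
  simp only [Pi.add_apply, Pi.smul_apply, smul_eq_mul, Pi.zero_apply] at this ⊢
  field_simp
  linarith

end Geodesic

/-- Two points of the open forward cone have a positive product. -/
lemma form_pos_of_mem_space_H2R {p q : Fin 3 → ℝ} (hp : p ∈ H2R.space) (hq : q ∈ H2R.space) :
    0 < H2R.form p q := by
  obtain ⟨hp, hp0⟩ := hp
  obtain ⟨hq, hq0⟩ := hq
  simp only [form, sign] at *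
  have hmul : (p 1 ^ 2 + p 2 ^ 2) * (q 1 ^ 2 + q 2 ^ 2) < (p 0 * q 0) ^ 2 := by
    rw [mul_pow]
    exact mul_lt_mul'' (by linarith) (by linarith) (by positivity) (by positivity)
  -- Lagrange's identity supplies Cauchy–Schwarz for the last two coordinates.
  have hcs : (p 1 * q 1 + p 2 * q 2) ^ 2 < (p 0 * q 0) ^ 2 := by
    linarith [sq_nonneg (p 1 * q 2 - p 2 * q 1)]
  linarith [lt_of_pow_lt_pow_left₀ 2 (by positivity) hcs]

/-- Polar coordinates in the plane of a geodesic. -/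
lemma Geodesic.exists_polar (g : X.Geodesic) {x : Fin 3 → ℝ} (hx : x ∈ X.space) {r s : ℝ}
    (h : x = r • g.a + s • g.b) :
    ∃ c θ : ℝ, 0 < c ∧ r = c * X.genCos θ ∧ s = c * X.genSin θ := by
  cases X
  · refine ⟨‖(⟨r, s⟩ : ℂ)‖, Complex.arg ⟨r, s⟩, norm_pos_iff.2 fun h0 => hx ?_, ?_, ?_⟩
    · have hr : r = 0 := congrArg Complex.re h0
      have hs : s = 0 := congrArg Complex.im h0
      simp [h, hr, hs]
    · exact (Complex.norm_mul_cos_arg ⟨r, s⟩).symm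
    · exact (Complex.norm_mul_sin_arg ⟨r, s⟩).symm
  · have hr : 0 < r := by
      have := form_pos_of_mem_space_H2R g.a_mem hx
      have hc := H2R.form_comb 1 0 r s g.a g.b
      rw [one_smul, zero_smul, add_zero, ← h, g.form_a, g.form_ab] at hc
      linarith
    have hrs : 0 < r ^ 2 - s ^ 2 := by
      have := hx.1
      rw [h, form_comb, g.form_a, g.form_ab, g.form_b, sign] at this
      linarith
    have hc : 0 < √(r ^ 2 - s ^ 2) := Real.sqrt_pos.2 hrs
    have hsq : √(r ^ 2 - s ^ 2) ^ 2 = r ^ 2 - s ^ 2 := Real.sq_sqrt hrs.le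
    have hsinh : s = √(r ^ 2 - s ^ 2) * Real.sinh (Real.arsinh (s / √(r ^ 2 - s ^ 2))) := by
      rw [Real.sinh_arsinh]; field_simp
    refine ⟨√(r ^ 2 - s ^ 2), Real.arsinh (s / √(r ^ 2 - s ^ 2)), hc, ?_, hsinh⟩
    refine (pow_left_inj₀ hr.le (mul_pos hc (Real.cosh_pos _)).le two_ne_zero).1 ?_
    rw [mul_pow, Real.cosh_sq, mul_add, ← mul_pow, ← hsinh, hsq]
    ring

/-- The central image of a geodesic that is not fibre-like is a plane section. -/
lemma Geodesic.mem_centralImage_iff (g : X.Geodesic) (hg : ¬ g.IsFibreLike)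
    {S : Set (Fin 3 → ℝ)} {x : Fin 3 → ℝ} (hxS : x ∈ S) (hx : x ∈ X.space) :
    x ∈ g.centralImage S ↔ x ⬝ᵥ g.normal = 0 := by
  constructor
  · rintro ⟨-, τ, c, -, rfl⟩
    rw [smul_dotProduct, g.curve_dotProduct_normal, smul_zero]
  · intro h
    obtain ⟨r, s, hrs⟩ := g.exists_eq_comb h
    obtain ⟨c, θ, hc, hr, hs⟩ := g.exists_polar hx hrs
    have hv : Real.cos g.v ≠ 0 := hg
    -- The parameter realizes the polar angle `θ`; the scalar replaces the exponential factor of the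
    -- curve by the polar radius.
    refine ⟨hxS, θ / Real.cos g.v,
      c / Real.exp (g.t₀ + θ / Real.cos g.v * Real.sin g.v), by positivity, ?_⟩
    rw [curve, smul_smul, div_mul_cancel₀ _ (Real.exp_ne_zero _), div_mul_cancel₀ _ hv, smul_add,
      smul_smul, smul_smul, ← hr, ← hs, hrs]

/-! ### Heights over a plane and Menelaus's relation -/

/-- The signed distance, up to scaling by the length of `n`, of the projection of `p` to the base
plane from the plane with normal vector `n`. -/
noncomputable def baseHeight (X : ProductGeometry) (n p : Fin 3 → ℝ) : ℝ :=
  p ⬝ᵥ n / √(X.form p p)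

lemma baseHeight_curve (g : X.Geodesic) (n : Fin 3 → ℝ) (τ : ℝ) :
    X.baseHeight n (g.curve τ) = g.basePoint τ ⬝ᵥ n := by
  rw [baseHeight, g.form_curve_self, Real.sqrt_sq (Real.exp_pos _).le, g.curve_eq, smul_dotProduct,
    smul_eq_mul, mul_div_cancel_left₀ _ (Real.exp_ne_zero _)]

/-- The simple ratio in which a plane through the centre divides two points of a geodesic. -/
lemma Geodesic.simpleRatio_eq_neg_div (g : X.Geodesic) {A P B n : Fin 3 → ℝ}
    (h : g.ConnectsThrough A P B) (hP : P ⬝ᵥ n = 0) (hA : X.baseHeight n A ≠ 0)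
    (hB : X.baseHeight n B ≠ 0) :
    g.simpleRatio A P B = -(X.baseHeight n A / X.baseHeight n B) := by
  obtain ⟨σ, ρ, τ, rfl, rfl, rfl, hστ, hσρ, hρτ⟩ := h
  rw [g.simpleRatio_curve hστ hσρ hρτ]
  have hP' : g.basePoint ρ ⬝ᵥ n = 0 := by
    rw [← baseHeight_curve, baseHeight, hP, zero_div]
  rw [baseHeight_curve] at hA hB ⊢
  rw [baseHeight_curve]
  have hrel := congrArg (· ⬝ᵥ n) (g.genSin_smul_basePoint_add σ ρ τ)
  simp only [add_dotProduct, smul_dotProduct, smul_eq_mul, hP', mul_zero] at hrel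
  -- A vanishing sine makes the base points of `P` and `B` proportional, which would put `B` in the
  -- plane. This also covers fibre-like sides.
  have hne : X.genSin ((τ - ρ) * Real.cos g.v) ≠ 0 := by
    intro h0
    have hcomb : g.basePoint τ = X.genCos ((τ - ρ) * Real.cos g.v) • g.basePoint ρ +
        X.genSin ((τ - ρ) * Real.cos g.v) • g.baseTangent ρ := by
      ext i
      have h1 := X.genCos_sq_add (ρ * Real.cos g.v)
      simp only [basePoint, baseTangent, sub_mul, genCos_sub, genSin_sub, Pi.add_apply,
        Pi.smul_apply, smul_eq_mul]
      linear_combination -(X.genCos (τ * Real.cos g.v) * g.a i +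
        X.genSin (τ * Real.cos g.v) * g.b i) * h1
    apply hB
    rw [hcomb, h0, zero_smul, add_zero, smul_dotProduct, hP', smul_zero]
  rw [← neg_div, div_eq_div_iff hne hB]
  linarith

/-- The conventions for the ratios `(0, 1)` and `(1, 0)` make the curve a singleton, so nearness is
trivial. Membership in `S` is what turns a vertex outside `l` into a vertex off the plane. -/
lemma mem_triangleSurface (X : ProductGeometry) (A₀ A₁ A₂ : Fin 3 → ℝ) :
    A₀ ∈ X.triangleSurface A₀ A₁ A₂ ∧ A₁ ∈ X.triangleSurface A₀ A₁ A₂ ∧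
      A₂ ∈ X.triangleSurface A₀ A₁ A₂ := by
  refine ⟨Or.inl ⟨0, 1, le_rfl, zero_le_one, by norm_num, ?_⟩, Or.inr rfl,
    Or.inl ⟨1, 0, zero_le_one, le_rfl, by norm_num, ?_⟩⟩ <;>
  simp [nearestPoints, apolloniusCurve]

end ProductGeometry

open ProductGeometry in
theorem theorem4p8 (X : ProductGeometry) (A₀ A₁ A₂ P Q R : Fin 3 → ℝ)
    (hA₀ : A₀ ∈ X.space) (hA₁ : A₁ ∈ X.space) (hA₂ : A₂ ∈ X.space)
    (hgen : X.IsGeneralLocation A₀ A₁ A₂)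
    -- `S` is the surface of the triangle, or any prolongation of it beyond the triangle
    (S : Set (Fin 3 → ℝ)) (hS : X.triangleSurface A₀ A₁ A₂ ⊆ S) (hSX : S ⊆ X.space)
    (l : Set (Fin 3 → ℝ)) (hl : X.IsLineIn S l)
    (hl₀ : A₀ ∉ l) (hl₁ : A₁ ∉ l) (hl₂ : A₂ ∉ l)
    (g₀₁ g₁₂ g₂₀ : X.Geodesic)
    (hP : g₀₁.ConnectsThrough A₀ P A₁) (hPl : P ∈ l)
    (hQ : g₁₂.ConnectsThrough A₁ Q A₂) (hQl : Q ∈ l)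
    (hR : g₂₀.ConnectsThrough A₂ R A₀) (hRl : R ∈ l) :
    g₀₁.simpleRatio A₀ P A₁ * g₁₂.simpleRatio A₁ Q A₂ * g₂₀.simpleRatio A₂ R A₀ = -1 := by
  obtain ⟨-, -, -, -, -, g, hg, -, rfl⟩ := hl
  have plane {x : Fin 3 → ℝ} (hx : x ∈ g.centralImage S) : x ⬝ᵥ g.normal = 0 :=
    (g.mem_centralImage_iff hg hx.1 (hSX hx.1)).1 hx
  have vertex {A B Y : Fin 3 → ℝ} {g' : X.Geodesic} (hAS : A ∈ X.triangleSurface A₀ A₁ A₂)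
      (hA : A ∈ X.space) (hAl : A ∉ g.centralImage S) (h : g'.ConnectsThrough A Y B) :
      X.baseHeight g.normal A ≠ 0 := by
    rw [g.mem_centralImage_iff hg (hS hAS) hA] at hAl
    obtain ⟨σ, -, -, rfl, -⟩ := h
    refine div_ne_zero hAl (Real.sqrt_ne_zero'.2 ?_)
    rw [g'.form_curve_self]
    positivity
  obtain ⟨hS₀, hS₁, hS₂⟩ := X.mem_triangleSurface A₀ A₁ A₂
  have h₀ := vertex hS₀ hA₀ hl₀ hP
  have h₁ := vertex hS₁ hA₁ hl₁ hQ
  have h₂ := vertex hS₂ hA₂ hl₂ hR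
  rw [g₀₁.simpleRatio_eq_neg_div hP (plane hPl) h₀ h₁,
    g₁₂.simpleRatio_eq_neg_div hQ (plane hQl) h₁ h₂,
    g₂₀.simpleRatio_eq_neg_div hR (plane hRl) h₂ h₀]
  field_simp
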